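/- **Theorem 5.3.** Let $\mathcal{C}$ be a (skeletally small) additive category with split idempotents that is Krull–Schmidt, i.e. every object of $\mathcal{C}$ is a finite direct sum of objects with local endomorphism ring. Let $\mathcal{B}$ be a full subcategory of $\mathcal{C}$ with $\mathcal{B}=\mathrm{add}(\mathcal{B})$, where $\mathrm{add}(\mathcal{B})$ consists of all direct summands of finite direct sums of objects of $\mathcal{B}$. Let $I_{\mathcal{B}}(X,Y)\subseteq\mathcal{C}(X,Y)$ be the subgroup of the morphisms that factor through an object of $\mathcal{B}$; this is a two-sided ideal, and $\mathcal{C}/I_{\mathcal{B}}$ denotes the quotient category, with the objects of $\mathcal{C}$ and the morphism groups $\mathcal{C}(X,Y)/I_{\mathcal{B}}(X,Y)$. For a preadditive category $\mathcal{D}$ let $\mathrm{Mod}(\mathcal{D})$ be the category of additive covariant functors from $\mathcal{D}$ to abelian groups. Let $$\mathcal{C}(\mathcal{C}/I_{\mathcal{B}},-)\colon \mathrm{Mod}(\mathcal{C})\longrightarrow \mathrm{Mod}(\mathcal{C}/I_{\mathcal{B}}),\qquad \mathcal{C}(\mathcal{C}/I_{\mathcal{B}},M)(X)=\mathrm{Hom}_{\mathrm{Mod}(\mathcal{C})}\!\left(\frac{\mathcal{C}(X,-)}{I_{\mathcal{B}}(X,-)},\,M\right),$$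 be the right adjoint of the restriction functor $\mathrm{Mod}(\mathcal{C}/I_{\mathcal{B}})\to\mathrm{Mod}(\mathcal{C})$ that occurs in the canonical recollement of $\mathrm{Mod}(\mathcal{C})$ by $\mathrm{Mod}(\mathcal{C}/I_{\mathcal{B}})$ and $\mathrm{Mod}(\mathcal{B})$ (this recollement exists for all such $\mathcal{C}$ and $\mathcal{B}$). If the functor $\mathcal{C}(\mathcal{C}/I_{\mathcal{B}},-)$ is exact, then there is an (additive) equivalence of categories $$\mathcal{C}\simeq\begin{bmatrix}\mathcal{B}&0\\ \overline{\mathrm{Hom}}&{}^{\perp_0}\mathcal{B}\end{bmatrix}.$$ Here ${}^{\perp_0}\mathcal{B}$ is the full subcategory of the objects $X$ of $\mathcal{C}$ with $\mathcal{C}(X,B)=0$ for all $B\in\mathcal{B}$, and $\overline{\mathrm{Hom}}\colon {}^{\perp_0}\mathcal{B}\otimes\mathcal{B}^{op}\to\mathbf{Ab}$ is the bifunctor $\overline{\mathrm{Hom}}(U,T)=\mathcal{C}(T,U)$. For preadditive categories $\mathcal{T},\mathcal{U}$ and a biadditive functor $M$ from $\mathcal{U}$ and $\mathcal{T}^{op}$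 to abelian groups, the triangular matrix category $\begin{bmatrix}\mathcal{T}&0\\ M&\mathcal{U}\end{bmatrix}$ has as objects the pairs $(T,U)$ with $T\in\mathcal{T}$ and $U\in\mathcal{U}$; the morphisms $(T,U)\to(T',U')$ are the matrices $\begin{bmatrix}t&0\\ m&u\end{bmatrix}$ with $t\in\mathcal{T}(T,T')$, $m\in M(U',T)$, $u\in\mathcal{U}(U,U')$, added entrywise and composed by $$\begin{bmatrix}t_2&0\\ m_2&u_2\end{bmatrix}\begin{bmatrix}t_1&0\\ m_1&u_1\end{bmatrix}=\begin{bmatrix}t_2t_1&0\\ M(1\otimes t_1)(m_2)+M(u_2\otimes 1)(m_1)&u_2u_1\end{bmatrix}.$$ -/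

import Mathlib

open CategoryTheory CategoryTheory.Limits Opposite

universe w v v₁ v₂ u u₁ u₂

noncomputable section

namespace TriangularMatrix

section Additive

variable {C : Type u} [Category.{v} C] [Preadditive C] [HasFiniteBiproducts C]

attribute [local instance] hasBinaryBiproducts_of_finite_biproducts

variable (C) in
/-- An additive category is Krull-Schmidt if every object is a finite direct sum of objects whose
endomorphism ring is local. -/
def IsKrullSchmidt : Prop :=
  ∀ X : C, ∃ (n : ℕ) (Z : Fin n → C),
    (∀ i, IsLocalRing (End (Z i))) ∧ Nonempty (X ≅ ⨁ Z)

/-- `add B`: the class of all direct summands of finite direct sums of objects of `B`. -/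
def addClosure (B : ObjectProperty C) : ObjectProperty C := fun X =>
  ∃ (n : ℕ) (Z : Fin n → C) (Y : C), (∀ i, B (Z i)) ∧ Nonempty (X ⊞ Y ≅ ⨁ Z)

/-- The morphism `f` factors through an object of `B`. -/
def FactorsThrough (B : ObjectProperty C) {X Y : C} (f : X ⟶ Y) : Prop :=
  ∃ (Z : C) (_ : B Z) (a : X ⟶ Z) (b : Z ⟶ Y), a ≫ b = f

theorem addClosure_biproduct (B : ObjectProperty C) {n : ℕ} (Z : Fin n → C) (hZ : ∀ i, B (Z i)) :
    addClosure B (⨁ Z) :=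
  ⟨n, Z, ⨁ (Fin.elim0 : Fin 0 → C), hZ, ⟨{
    hom := biprod.fst
    inv := biprod.inl
    hom_inv_id := by
      apply biprod.hom_ext
      · simp
      · apply biproduct.hom_ext
        intro i
        exact i.elim0
    inv_hom_id := by simp }⟩⟩

/-- The group `I_B(X, Y)` of the morphisms from `X` to `Y` that factor through an object of `B`. -/
def ideal (B : ObjectProperty C) (hB : B = addClosure B) (X Y : C) : AddSubgroup (X ⟶ Y) where
  carrier := {f | FactorsThrough B f}
  zero_mem' := ⟨⨁ (Fin.elim0 : Fin 0 → C),
    hB ▸ addClosure_biproduct B Fin.elim0 (fun i => i.elim0), 0, 0, by simp⟩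
  add_mem' := by
    rintro f g ⟨Z, hZ, a, b, rfl⟩ ⟨W, hW, c, d, rfl⟩
    have h : B (⨁ ![Z, W]) := by
      rw [hB]
      exact addClosure_biproduct B _ (by intro i; fin_cases i <;> assumption)
    have key : ∀ (i j : Fin 2) (x : X ⟶ ![Z, W] i) (y : ![Z, W] j ⟶ Y),
        (x ≫ biproduct.ι ![Z, W] i) ≫ biproduct.π ![Z, W] j ≫ y =
          x ≫ (biproduct.ι ![Z, W] i ≫ biproduct.π ![Z, W] j) ≫ y := by simp
    have h0 : biproduct.ι ![Z, W] 0 ≫ biproduct.π ![Z, W] 0 = 𝟙 _ := biproduct.ι_π_self _ _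
    have h1 : biproduct.ι ![Z, W] 1 ≫ biproduct.π ![Z, W] 1 = 𝟙 _ := biproduct.ι_π_self _ _
    have h01 : biproduct.ι ![Z, W] 0 ≫ biproduct.π ![Z, W] 1 = 0 :=
      biproduct.ι_π_ne _ (by decide)
    have h10 : biproduct.ι ![Z, W] 1 ≫ biproduct.π ![Z, W] 0 = 0 :=
      biproduct.ι_π_ne _ (by decide)
    let a' : X ⟶ ![Z, W] 0 := a
    let b' : ![Z, W] 0 ⟶ Y := b
    let c' : X ⟶ ![Z, W] 1 := c
    let d' : ![Z, W] 1 ⟶ Y := d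
    refine ⟨⨁ ![Z, W], h, a' ≫ biproduct.ι ![Z, W] 0 + c' ≫ biproduct.ι ![Z, W] 1,
      biproduct.π ![Z, W] 0 ≫ b' + biproduct.π ![Z, W] 1 ≫ d', ?_⟩
    rw [Preadditive.add_comp, Preadditive.comp_add, Preadditive.comp_add, key, key, key, key,
      h0, h1, h01, h10]
    simp only [Category.id_comp, zero_comp, comp_zero, add_zero, zero_add]
    rfl
  neg_mem' := by
    rintro f ⟨Z, hZ, a, b, rfl⟩
    exact ⟨Z, hZ, -a, b, by simp⟩

theorem comp_mem_ideal (B : ObjectProperty C) (hB : B = addClosure B) {X Y Z : C} (g : X ⟶ Y)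
    {f : Y ⟶ Z} (hf : f ∈ ideal B hB Y Z) : g ≫ f ∈ ideal B hB X Z := by
  obtain ⟨W, hW, a, b, rfl⟩ := hf
  exact ⟨W, hW, g ≫ a, b, by simp⟩

theorem mem_ideal_comp (B : ObjectProperty C) (hB : B = addClosure B) {X Y Z : C}
    {f : X ⟶ Y} (hf : f ∈ ideal B hB X Y) (g : Y ⟶ Z) : f ≫ g ∈ ideal B hB X Z := by
  obtain ⟨W, hW, a, b, rfl⟩ := hf
  exact ⟨W, hW, a, b ≫ g, by simp⟩

/-- Two parallel morphisms are identified if their difference lies in `I_B`. -/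
def idealRel (B : ObjectProperty C) (hB : B = addClosure B) : HomRel C :=
  fun X Y f g => f - g ∈ ideal B hB X Y

instance (B : ObjectProperty C) (hB : B = addClosure B) : Congruence (idealRel B hB) where
  equivalence :=
    { refl := fun f => by simp [idealRel, (ideal B hB _ _).zero_mem]
      symm := fun {f g} h => by
        have := (ideal B hB _ _).neg_mem h
        rwa [neg_sub] at this
      trans := fun {f g k} h h' => by
        have := (ideal B hB _ _).add_mem h h'
        rwa [sub_add_sub_cancel] at this }
  comp_left := fun f _ _ h => by
    have := comp_mem_ideal B hB f h
    rwa [Preadditive.comp_sub] at this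
  comp_right := fun g h => by
    have := mem_ideal_comp B hB h g
    rwa [Preadditive.sub_comp] at this

theorem idealRel_add (B : ObjectProperty C) (hB : B = addClosure B) ⦃X Y : C⦄
    (f₁ f₂ g₁ g₂ : X ⟶ Y) (hf : idealRel B hB f₁ f₂) (hg : idealRel B hB g₁ g₂) :
    idealRel B hB (f₁ + g₁) (f₂ + g₂) := by
  have := (ideal B hB _ _).add_mem hf hg
  rwa [sub_add_sub_comm] at this

/-- The quotient category `C / I_B`: same objects as `C`, and morphisms `C(X, Y) / I_B(X, Y)`. -/
abbrev QuotCat (B : ObjectProperty C) (hB : B = addClosure B) : Type u :=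
  CategoryTheory.Quotient (idealRel B hB)

instance (B : ObjectProperty C) (hB : B = addClosure B) : Preadditive (QuotCat B hB) :=
  Quotient.preadditive (idealRel B hB) (idealRel_add B hB)

/-- The canonical projection `C ⥤ C / I_B`. -/
abbrev proj (B : ObjectProperty C) (hB : B = addClosure B) : C ⥤ QuotCat B hB :=
  Quotient.functor (idealRel B hB)

instance (B : ObjectProperty C) (hB : B = addClosure B) : (proj B hB).Additive :=
  Quotient.functor_additive (idealRel B hB) (idealRel_add B hB)

end Additive

/-- `Mod(D)`: the category of additive covariant functors from `D` to abelian groups. -/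
abbrev ModCat (D : Type u) [Category.{v} D] [Preadditive D] :=
  D ⥤+ AddCommGrpCat.{w}

/-- The representable modules: `X ↦ D(X, -)`, contravariant in `X`. -/
def representable (D : Type u) [Category.{v} D] [Preadditive D] : Dᵒᵖ ⥤ ModCat.{v} D :=
  ObjectProperty.lift _ preadditiveCoyoneda
    (fun X => (inferInstance : (preadditiveCoyoneda.obj X).Additive))

instance (D : Type u) [Category.{v} D] [Preadditive D] : (representable D).Additive where
  map_add {X Y f g} := by
    refine ObjectProperty.hom_ext _ ?_
    ext Z k
    exact Preadditive.add_comp _ _ _ _ _ _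

section Recollement

variable {C : Type u} [Category.{v} C] [Preadditive C] [HasFiniteBiproducts C]

/-- The restriction functor `Mod(C / I_B) ⥤ Mod(C)`, `F ↦ F ∘ π`. -/
def res (B : ObjectProperty C) (hB : B = addClosure B) : ModCat.{w} (QuotCat B hB) ⥤ ModCat.{w} C :=
  ObjectProperty.lift _
    (ObjectProperty.ι _ ⋙ (Functor.whiskeringLeft _ _ _).obj (proj B hB))
    (fun F => (inferInstance : (proj B hB ⋙ F.obj).Additive))

instance (B : ObjectProperty C) (hB : B = addClosure B) : (res.{w} B hB).Additive where
  map_add := rfl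

/-- The `C`-modules `C(X, -) / I_B(X, -)`, contravariantly functorial in the object `X` of
`C / I_B`. The value of this module at `Y` is `C(X, Y) / I_B(X, Y)`, the group of morphisms from
`X` to `Y` in `C / I_B`. -/
def quotientModule (B : ObjectProperty C) (hB : B = addClosure B) : (QuotCat B hB)ᵒᵖ ⥤ ModCat.{v} C :=
  representable (QuotCat B hB) ⋙ res B hB

instance (B : ObjectProperty C) (hB : B = addClosure B) : (quotientModule B hB).Additive :=
  inferInstanceAs (representable (QuotCat B hB) ⋙ res B hB).Additive

/-- The functor `C(C / I_B, -) : Mod(C) ⥤ Mod(C / I_B)`, which sends a `C`-module `M` to the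
`C / I_B`-module `X ↦ Hom (C(X, -) / I_B(X, -), M)`, where `Hom` is the group of morphisms of
`C`-modules. As `C` may have more objects than fit into the universe `v` of its morphism sets,
these groups live in the universe `max u v`. -/
def coinduced (B : ObjectProperty C) (hB : B = addClosure B) :
    ModCat.{v} C ⥤ ModCat.{max u v} (QuotCat B hB) :=
  ObjectProperty.lift _
    (preadditiveYoneda ⋙
      (Functor.whiskeringLeft _ _ _).obj (quotientModule B hB).rightOp)
    (fun M => (inferInstance :
      ((quotientModule B hB).rightOp ⋙ preadditiveYoneda.obj M).Additive))

end Recollement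

section Matrix

variable {T : Type u₁} [Category.{v₁} T] {U : Type u₂} [Category.{v₂} U]

/-- The objects of the triangular matrix category `[[T, 0], [M, U]]`. -/
@[ext]
structure MatrixCat (M : U ⥤ Tᵒᵖ ⥤ AddCommGrpCat.{w}) where
  /-- the upper left entry -/
  t : T
  /-- the lower right entry -/
  u : U

namespace MatrixCat

variable {M : U ⥤ Tᵒᵖ ⥤ AddCommGrpCat.{w}}

/-- A morphism from `[[t, 0], [M, u]]` to `[[t', 0], [M, u']]` is a matrix `[[a, 0], [m, b]]` with
`a : t ⟶ t'`, `m ∈ M(u', t)` and `b : u ⟶ u'`. -/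
@[ext]
structure Hom (X Y : MatrixCat M) where
  /-- the upper left entry -/
  a : X.t ⟶ Y.t
  /-- the lower left entry -/
  m : (M.obj Y.u).obj (op X.t)
  /-- the lower right entry -/
  b : X.u ⟶ Y.u

/-- Composition is the product of matrices, where `m₂ • a₁ = M(1 ⊗ a₁)(m₂)` and
`b₂ • m₁ = M(b₂ ⊗ 1)(m₁)`. -/
instance : Category (MatrixCat M) where
  Hom := Hom
  id X := ⟨𝟙 _, 0, 𝟙 _⟩
  comp {X Y Z} f g :=
    ⟨f.a ≫ g.a, (M.obj Z.u).map f.a.op g.m + (M.map g.b).app (op X.t) f.m, f.b ≫ g.b⟩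
  id_comp f := by ext <;> simp
  comp_id f := by ext <;> simp
  assoc {W X Y Z} f g h := by
    ext
    · simp
    · have e : (M.map h.b).app (op W.t) ((M.obj Y.u).map f.a.op g.m) =
          (M.obj Z.u).map f.a.op ((M.map h.b).app (op X.t) g.m) := by
        have := (M.map h.b).naturality f.a.op
        exact congrArg (fun k => k g.m) this
      simp [e, add_assoc]
    · simp

@[ext]
theorem hom_ext {X Y : MatrixCat M} {f g : X ⟶ Y} (ha : f.a = g.a) (hm : f.m = g.m)
    (hb : f.b = g.b) : f = g :=
  Hom.ext ha hm hb

@[simp] theorem id_a (X : MatrixCat M) : Hom.a (𝟙 X) = 𝟙 X.t := rfl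
@[simp] theorem id_m (X : MatrixCat M) : Hom.m (𝟙 X) = 0 := rfl
@[simp] theorem id_b (X : MatrixCat M) : Hom.b (𝟙 X) = 𝟙 X.u := rfl

section

variable {X Y Z : MatrixCat M} (f : X ⟶ Y) (g : Y ⟶ Z)

@[simp] theorem comp_a : (f ≫ g).a = f.a ≫ g.a := rfl
@[simp] theorem comp_m : (f ≫ g).m =
    (M.obj Z.u).map f.a.op g.m + (M.map g.b).app (op X.t) f.m := rfl
@[simp] theorem comp_b : (f ≫ g).b = f.b ≫ g.b := rfl

end

variable [Preadditive T] [Preadditive U]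

instance (X Y : MatrixCat M) : Zero (X ⟶ Y) := ⟨(⟨0, 0, 0⟩ : Hom X Y)⟩

instance (X Y : MatrixCat M) : Add (X ⟶ Y) :=
  ⟨fun f g => (⟨f.a + g.a, f.m + g.m, f.b + g.b⟩ : Hom X Y)⟩

instance (X Y : MatrixCat M) : Neg (X ⟶ Y) := ⟨fun f => (⟨-f.a, -f.m, -f.b⟩ : Hom X Y)⟩

/-- Matrices are added entrywise. -/
instance (X Y : MatrixCat M) : AddCommGroup (X ⟶ Y) where
  add_assoc _ _ _ := hom_ext (add_assoc _ _ _) (add_assoc _ _ _) (add_assoc _ _ _)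
  zero_add _ := hom_ext (zero_add _) (zero_add _) (zero_add _)
  add_zero _ := hom_ext (add_zero _) (add_zero _) (add_zero _)
  add_comm _ _ := hom_ext (add_comm _ _) (add_comm _ _) (add_comm _ _)
  neg_add_cancel _ := hom_ext (neg_add_cancel _) (neg_add_cancel _) (neg_add_cancel _)
  nsmul := nsmulRec
  zsmul := zsmulRec

section

variable {X Y : MatrixCat M} (f g : X ⟶ Y)

@[simp] theorem add_a : (f + g).a = f.a + g.a := rfl
@[simp] theorem add_m : (f + g).m = f.m + g.m := rfl
@[simp] theorem add_b : (f + g).b = f.b + g.b := rfl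

end

instance [M.Additive] [∀ u, (M.obj u).Additive] : Preadditive (MatrixCat M) where
  add_comp X Y Z f g h := by
    ext
    · simp
    · simp [Functor.map_add]
      abel
    · simp
  comp_add X Y Z f g h := by
    ext
    · simp
    · simp [Functor.map_add]
      abel
    · simp

end MatrixCat

end Matrix

section HomBar

variable {C : Type u} [Category.{v} C] [Preadditive C]

/-- For full subcategories `B` and `A` of `C`, the bifunctor `A ⊗ Bᵒᵖ → Ab` that sends a pair
`(X, Y)` to `C(Y, X)`. -/
def homBar (B A : ObjectProperty C) :
    A.FullSubcategory ⥤ B.FullSubcategoryᵒᵖ ⥤ AddCommGrpCat.{v} :=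
  A.ι ⋙ preadditiveYoneda ⋙ (Functor.whiskeringLeft _ _ _).obj B.ι.op

instance (B A : ObjectProperty C) : (homBar B A).Additive where
  map_add {X Y f g} := by
    ext Z h
    exact Preadditive.comp_add _ _ _ _ _ _

instance (B A : ObjectProperty C) (X : A.FullSubcategory) : ((homBar B A).obj X).Additive where
  map_add {Y Z f g} := by
    ext h
    exact Preadditive.add_comp _ _ _ _ _ _

end HomBar

end TriangularMatrix

end

/-!
Exactness of `C(C / I_B, -)` forces every `C`-module `C(X, -) / I_B(X, -)` to be projective relative
to the canonical epimorphism `C(X, -) ⟶ C(X, -) / I_B(X, -)`: the functor sends this epimorphism to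
an epimorphism of `C / I_B`-modules, which is pointwise surjective
(`surjective_app_of_epi`), so that the identity of `C(X, -) / I_B(X, -)` lifts along it. By the
Yoneda lemma the resulting section is an endomorphism `p` of `X` with `𝟙 X - p ∈ I_B(X, X)` and
`p ≫ f = 0` for all `f ∈ I_B(X, Y)` (`exists_annihilating_endomorphism`).

Such a `p` is idempotent. The summand of `X` cut out by `𝟙 X - p` is a retract of an object of `B`,
hence lies in `B = add B`, and the summand cut out by `p` has no nonzero morphisms to `B`. Thus
every object of `C` is a direct sum `T ⊞ U` with `T ∈ B` and `U ∈ ⊥₀B`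
(`exists_biprod_iso_of_exact`). A morphism `T ⊞ U ⟶ T' ⊞ U'` between such sums is a matrix whose
component `U ⟶ T'` vanishes, so `(T, U) ↦ T ⊞ U` is an additive, fully faithful and essentially
surjective functor from the triangular matrix category to `C`.
-/

namespace TriangularMatrix

attribute [local instance] hasBinaryBiproducts_of_finite_biproducts

section Epi

variable {D : Type u} [Category.{v} D] [Preadditive D]

/-- The pointwise cokernel of a morphism of modules, which is again an additive functor. -/
noncomputable def pointwiseCokernel {F G : ModCat.{w} D} (f : F ⟶ G) : ModCat.{w} D where
  obj := cokernel f.hom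
  property := by
    refine ⟨fun {X Y g h} => ?_⟩
    -- The components of the projection are epimorphisms, so additivity descends from `G`.
    have hG : G.obj.map (g + h) = G.obj.map g + G.obj.map h := G.property.map_add
    rw [← cancel_epi ((cokernel.π f.hom).app X), ← NatTrans.naturality, hG,
      Preadditive.add_comp, Preadditive.comp_add, NatTrans.naturality, NatTrans.naturality]

/-- Epimorphisms of modules are pointwise surjective: an epimorphism has zero pointwise
cokernel. -/
theorem surjective_app_of_epi {F G : ModCat.{w} D} (f : F ⟶ G) [Epi f] (X : D) :
    Function.Surjective (f.hom.app X) := by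
  let c : G ⟶ pointwiseCokernel f := ObjectProperty.homMk (cokernel.π f.hom)
  have hc : c = 0 := by
    rw [← cancel_epi f, comp_zero]
    exact ObjectProperty.hom_ext _ (cokernel.condition f.hom)
  have h0 : cokernel.π f.hom = 0 := congrArg (fun k => k.hom) hc
  have : Epi f.hom := Preadditive.epi_of_cokernel_zero h0
  exact (AddCommGrpCat.epi_iff_surjective _).1 inferInstance

end Epi

section Decomposition

variable {C : Type u} [Category.{v} C] [Preadditive C] [HasFiniteBiproducts C]

/-- Two retracts of `X` whose idempotents add up to the identity are complementary direct
summands. -/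
theorem nonempty_biprod_iso {X P Q : C} {i : P ⟶ X} {r : X ⟶ P} {j : Q ⟶ X} {s : X ⟶ Q}
    (hi : i ≫ r = 𝟙 P) (hj : j ≫ s = 𝟙 Q) (h : r ≫ i + s ≫ j = 𝟙 X) :
    Nonempty (P ⊞ Q ≅ X) := by
  have h₁ : i ≫ s = 0 := by
    have := congrArg (fun k => i ≫ k ≫ s) h
    simpa [reassoc_of% hi, hj] using this
  have h₂ : j ≫ r = 0 := by
    have := congrArg (fun k => j ≫ k ≫ r) h
    simpa [reassoc_of% hj, hi] using this
  exact ⟨{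
    hom := biprod.desc i j
    inv := biprod.lift r s
    hom_inv_id := by
      ext <;> simp [hi, hj, h₁, h₂]
    inv_hom_id := by simpa [biprod.lift_desc] using h }⟩

/-- In an idempotent complete category, the class `B = add B` contains every retract of its
objects. -/
theorem of_retract [IsIdempotentComplete C] {B : ObjectProperty C} (hB : B = addClosure B)
    {X W : C} (hW : B W) (i : X ⟶ W) (r : W ⟶ X) (h : i ≫ r = 𝟙 X) : B X := by
  obtain ⟨Y, j, s, hj, hs⟩ := IsIdempotentComplete.idempotents_split W (𝟙 W - r ≫ i)
    (by simp [reassoc_of% h])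
  obtain ⟨e⟩ := nonempty_biprod_iso h hj (by rw [hs]; abel)
  rw [hB]
  exact ⟨1, fun _ => W, Y, fun _ => hW,
    ⟨e ≪≫ (biproductUniqueIso (fun _ : Fin 1 => W)).symm⟩⟩

variable (B : ObjectProperty C) (hB : B = addClosure B)

/-- The canonical projection `C(X, -) ⟶ C(X, -) / I_B(X, -)`. -/
noncomputable def toQuotientModule (X : C) :
    (representable C).obj (op X) ⟶ (quotientModule B hB).obj (op ((proj B hB).obj X)) :=
  ObjectProperty.homMk
    { app := fun _ => AddCommGrpCat.ofHom (proj B hB).mapAddHom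
      naturality := fun Y Z f => by
        ext g
        exact (proj B hB).map_comp g f }

instance (X : C) : Epi (toQuotientModule B hB X) where
  left_cancellation {N} f g h := by
    refine ObjectProperty.hom_ext _ ?_
    ext Y k
    obtain ⟨k, rfl⟩ := (proj B hB).map_surjective k
    exact congrArg (fun l => l.hom.app Y k) h

variable {B} in
/-- A section of `C(X, -) ⟶ C(X, -) / I_B(X, -)` exhibits `I_B(X, -)` as a direct summand of
`C(X, -)`. By the Yoneda lemma it is given by an endomorphism of `X`. -/
theorem exists_annihilating_endomorphism
    (hexact : exactFunctor _ _ (coinduced B hB)) (X : C) :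
    ∃ p : X ⟶ X, 𝟙 X - p ∈ ideal B hB X X ∧
      ∀ ⦃Y : C⦄ (f : X ⟶ Y), f ∈ ideal B hB X Y → p ≫ f = 0 := by
  have : PreservesFiniteColimits (coinduced B hB) := hexact.2
  let q := toQuotientModule B hB X
  obtain ⟨s, hs⟩ := surjective_app_of_epi ((coinduced B hB).map q) ((proj B hB).obj X) (𝟙 _)
  change (quotientModule B hB).obj (op ((proj B hB).obj X)) ⟶ (representable C).obj (op X) at s
  replace hs : s ≫ q = 𝟙 _ := hs
  -- `σ` evaluates the section on classes of morphisms of `C`.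
  let σ (Y : C) (f : X ⟶ Y) : X ⟶ Y := s.hom.app Y ((proj B hB).map f)
  have hσ : ∀ (Y : C) (f : X ⟶ Y), σ X (𝟙 X) ≫ f = σ Y f := fun Y f => by
    have h := congrArg (fun k => k ((proj B hB).map (𝟙 X))) (s.hom.naturality f)
    refine h.symm.trans ?_
    change s.hom.app Y ((proj B hB).map (𝟙 X) ≫ (proj B hB).map f) = _
    rw [← Functor.map_comp, Category.id_comp]
  refine ⟨σ X (𝟙 X), ?_, fun Y f hf => ?_⟩
  · have h : (proj B hB).map (σ X (𝟙 X)) = (proj B hB).map (𝟙 X) :=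
      congrArg (fun k => k.hom.app X ((proj B hB).map (𝟙 X))) hs
    exact (Quotient.functor_map_eq_iff _ _ _).1 h.symm
  · have h : (proj B hB).map f = (proj B hB).map 0 :=
      (Quotient.functor_map_eq_iff _ _ _).2 (by simpa [idealRel] using hf)
    rw [hσ]
    change s.hom.app Y ((proj B hB).map f) = 0
    rw [h, Functor.map_zero]
    exact map_zero (s.hom.app Y).hom

variable {B} in
/-- Every object is the direct sum of an object of `B` and an object of `⊥₀B`. -/
theorem exists_biprod_iso_of_exact [IsIdempotentComplete C]
    (hexact : exactFunctor _ _ (coinduced B hB)) (X : C) :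
    ∃ (T U : C), B T ∧ B.leftOrthogonal U ∧ Nonempty (T ⊞ U ≅ X) := by
  obtain ⟨p, hp, hann⟩ := exists_annihilating_endomorphism hB hexact X
  have hidem : p ≫ p = p := by
    have := hann _ hp
    rw [Preadditive.comp_sub, Category.comp_id, sub_eq_zero] at this
    exact this.symm
  obtain ⟨U, j, s, hj, hs⟩ := IsIdempotentComplete.idempotents_split X p hidem
  obtain ⟨T, i, r, hi, hr⟩ := IsIdempotentComplete.idempotents_split X (𝟙 X - p)
    (by simp [hidem])
  obtain ⟨W, hW, a, b, hab⟩ := hp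
  refine ⟨T, U, ?_, fun Y f hY => ?_, nonempty_biprod_iso hi hj (by rw [hr, hs]; abel)⟩
  · refine of_retract hB hW (i ≫ a) (b ≫ r) ?_
    simp [reassoc_of% hab, ← hr, hi]
  · -- `f` is the restriction to `U` of `s ≫ f`, which factors through `Y` and is killed by `p`.
    have h := hann (s ≫ f) ⟨Y, hY, s ≫ f, 𝟙 Y, by simp⟩
    rw [← hs] at h
    simpa [reassoc_of% hj] using congrArg (fun k => j ≫ k) h

end Decomposition

section Sum

variable {C : Type u} [Category.{v} C] [Preadditive C] [HasFiniteBiproducts C]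

/-- The morphism `T ⊞ U ⟶ T' ⊞ U'` with components `a`, `m`, `b` and zero component `U ⟶ T'`. -/
noncomputable def triangularHom {T U T' U' : C} (a : T ⟶ T') (m : T ⟶ U') (b : U ⟶ U') :
    T ⊞ U ⟶ T' ⊞ U' :=
  biprod.desc (biprod.lift a m) (biprod.lift 0 b)

theorem triangularHom_id (T U : C) : triangularHom (𝟙 T) 0 (𝟙 U) = 𝟙 (T ⊞ U) := by
  unfold triangularHom
  ext <;> simp

theorem triangularHom_comp {T U T' U' T'' U'' : C} (a : T ⟶ T') (m : T ⟶ U') (b : U ⟶ U')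
    (a' : T' ⟶ T'') (m' : T' ⟶ U'') (b' : U' ⟶ U'') :
    triangularHom a m b ≫ triangularHom a' m' b' =
      triangularHom (a ≫ a') (a ≫ m' + m ≫ b') (b ≫ b') := by
  unfold triangularHom
  ext <;> simp [biprod.lift_desc]

theorem triangularHom_add {T U T' U' : C} (a a' : T ⟶ T') (m m' : T ⟶ U') (b b' : U ⟶ U') :
    triangularHom (a + a') (m + m') (b + b') = triangularHom a m b + triangularHom a' m' b' := by
  unfold triangularHom
  ext <;> simp

theorem triangularHom_injective {T U T' U' : C} {a a' : T ⟶ T'} {m m' : T ⟶ U'} {b b' : U ⟶ U'}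
    (h : triangularHom a m b = triangularHom a' m' b') : a = a' ∧ m = m' ∧ b = b' := by
  unfold triangularHom at h
  refine ⟨?_, ?_, ?_⟩
  · simpa using congrArg (fun k => biprod.inl ≫ k ≫ biprod.fst) h
  · simpa using congrArg (fun k => biprod.inl ≫ k ≫ biprod.snd) h
  · simpa using congrArg (fun k => biprod.inr ≫ k ≫ biprod.snd) h

theorem triangularHom_components {T U T' U' : C} (f : T ⊞ U ⟶ T' ⊞ U')
    (h : biprod.inr ≫ f ≫ biprod.fst = 0) :
    triangularHom (biprod.inl ≫ f ≫ biprod.fst) (biprod.inl ≫ f ≫ biprod.snd)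
      (biprod.inr ≫ f ≫ biprod.snd) = f := by
  unfold triangularHom
  ext <;> simp [h]

/-- The functor from the triangular matrix category to `C` that sends `(T, U)` to `T ⊞ U` and
a matrix to the morphism with these components. -/
noncomputable def biprodFunctor (B A : ObjectProperty C) : MatrixCat (homBar B A) ⥤ C where
  obj X := X.t.obj ⊞ X.u.obj
  map f := triangularHom f.a.hom f.m f.b.hom
  map_id X := triangularHom_id X.t.obj X.u.obj
  map_comp f g := (triangularHom_comp f.a.hom f.m f.b.hom g.a.hom g.m g.b.hom).symm

instance (B A : ObjectProperty C) : (biprodFunctor B A).Additive where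
  map_add {_ _ f g} := triangularHom_add f.a.hom g.a.hom f.m g.m f.b.hom g.b.hom

instance (B A : ObjectProperty C) : (biprodFunctor B A).Faithful where
  map_injective h :=
    have ⟨ha, hm, hb⟩ := triangularHom_injective h
    MatrixCat.hom_ext (ObjectProperty.hom_ext _ ha) hm (ObjectProperty.hom_ext _ hb)

instance (B : ObjectProperty C) : (biprodFunctor B B.leftOrthogonal).Full where
  map_surjective {X Y} f :=
    ⟨(⟨ObjectProperty.homMk (biprod.inl ≫ f ≫ biprod.fst),
      (biprod.inl ≫ f ≫ biprod.snd : X.t.obj ⟶ Y.u.obj),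
      ObjectProperty.homMk (biprod.inr ≫ f ≫ biprod.snd)⟩ : MatrixCat.Hom X Y),
      triangularHom_components f (X.u.property _ Y.t.property)⟩

end Sum

end TriangularMatrix

/-- Let `C` be a Krull-Schmidt additive category with split idempotents and `B = add B` a full
subcategory of `C`. If the functor `C(C / I_B, -) : Mod(C) ⥤ Mod(C / I_B)` is exact, then `C` is
equivalent to the triangular matrix category `[[B, 0], [Hom, ⊥₀B]]`. -/
theorem theorem5p3 {C : Type u} [Category.{v} C] [Preadditive C] [HasFiniteBiproducts C]
    [IsIdempotentComplete C] (hC : TriangularMatrix.IsKrullSchmidt C)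
    (B : ObjectProperty C) (hB : B = TriangularMatrix.addClosure B)
    (hexact : exactFunctor _ _ (TriangularMatrix.coinduced B hB)) :
    ∃ e : C ≌ TriangularMatrix.MatrixCat (TriangularMatrix.homBar B B.leftOrthogonal),
      e.functor.Additive := by
  have : (TriangularMatrix.biprodFunctor B B.leftOrthogonal).EssSurj :=
    ⟨fun X => by
      obtain ⟨T, U, hT, hU, e⟩ := TriangularMatrix.exists_biprod_iso_of_exact hB hexact X
      exact ⟨⟨⟨T, hT⟩, ⟨U, hU⟩⟩, e⟩⟩
  have : (TriangularMatrix.biprodFunctor B B.leftOrthogonal).IsEquivalence := {}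
  let e := (TriangularMatrix.biprodFunctor B B.leftOrthogonal).asEquivalence
  have : e.functor.Additive :=
    inferInstanceAs (TriangularMatrix.biprodFunctor B B.leftOrthogonal).Additive
  exact ⟨e.symm, e.inverse_additive⟩
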